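/- Let $\Delta=\{\zeta\in\mathbb{C}: |\zeta|<1\}$, with the Poincaré distance \[ k_\Delta(\zeta_1,\zeta_2)=\tfrac12\log\frac{1+|t|}{1-|t|},\qquad t=\frac{\zeta_1-\zeta_2}{1-\overline{\zeta_1}\,\zeta_2}. \] For a domain (non-empty connected open set) $D\subset\mathbb{C}^n$ and $z,w\in D$ let \[ \delta_D(z,w)=\inf\{k_\Delta(\zeta_0,\zeta_1) : \text{there is a holomorphic } \varphi:\Delta\to D \text{ with } \varphi(\zeta_0)=z,\ \varphi(\zeta_1)=w\}\in[0,+\infty] \] be the Lempert function (with $\inf\emptyset=+\infty$), and let \[ k_D(z,w)=\inf\Bigl\{\sum_{j=1}^m\delta_D(z_{j-1},z_j) : m\in\mathbb{N},\ z_0=z,\ z_m=w,\ z_1,\dots,z_{m-1}\in D\Bigr\} \] be the Kobayashi distance of $D$, which is finite. If $D$ is bounded, the small and the large horosphere of center $x\in\partial D$, radius $R>0$ and pole $z_0\in D$ are \[ E_{z_0}(x,R)=\Bigl\{z\in D : \limsup_{w\to x,\,w\in D}\,[k_D(z,w)-k_D(z_0,w)]<\tfrac12\log R\Bigr\}, \]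 \[ F_{z_0}(x,R)=\Bigl\{z\in D : \liminf_{w\to x,\,w\in D}\,[k_D(z,w)-k_D(z_0,w)]<\tfrac12\log R\Bigr\}. \] Theorem. Let $D\subset\mathbb{C}^n$ be a bounded convex domain and let $f:D\to D$ be a holomorphic map without fixed points. Then there exists $x\in\partial D$ such that \[ f^k\bigl(E_{z_0}(x,R)\bigr)\subseteq F_{z_0}(x,R) \] for every $z_0\in D$, every $R>0$ and every $k\in\mathbb{N}$, where $f^k$ denotes the $k$-th iterate of $f$. -/

import Mathlib

open Set Filter Topology

noncomputable section

/-- The Poincaré distance of the open unit disk of `ℂ`,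
`½ log ((1 + |t|) / (1 - |t|))` with `t = (ζ₁ - ζ₂) / (1 - conj ζ₁ * ζ₂)`
(metric `|dζ| / (1 - |ζ|²)`, curvature `-4`). It is used only for `ζ₁, ζ₂` in the disk. -/
def poincareDist (ζ₁ ζ₂ : ℂ) : ℝ :=
  1 / 2 * Real.log
    ((1 + ‖(ζ₁ - ζ₂) / (1 - (starRingEnd ℂ) ζ₁ * ζ₂)‖) /
      (1 - ‖(ζ₁ - ζ₂) / (1 - (starRingEnd ℂ) ζ₁ * ζ₂)‖))

variable {E : Type*} [NormedAddCommGroup E] [NormedSpace ℂ E]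

/-- `IsHolDisk D φ`: the map `φ` is (on the open unit disk) a holomorphic map from the
open unit disk into `D`. -/
def IsHolDisk (D : Set E) (φ : ℂ → E) : Prop :=
  DifferentiableOn ℂ φ (Metric.ball 0 1) ∧ MapsTo φ (Metric.ball 0 1) D

/-- The Lempert function of `D`: the infimum of the Poincaré distances `k(ζ₀, ζ₁)` over all
holomorphic disks `φ` in `D` with `φ ζ₀ = z` and `φ ζ₁ = w` (and `∞` if there are none). -/
def lempertFun (D : Set E) (z w : E) : ENNReal :=
  sInf {r : ENNReal | ∃ (φ : ℂ → E) (ζ₀ ζ₁ : ℂ), IsHolDisk D φ ∧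
    ζ₀ ∈ Metric.ball (0 : ℂ) 1 ∧ ζ₁ ∈ Metric.ball (0 : ℂ) 1 ∧ φ ζ₀ = z ∧ φ ζ₁ = w ∧
    r = ENNReal.ofReal (poincareDist ζ₀ ζ₁)}

/-- The Kobayashi pseudodistance of `D` with values in `[0, ∞]`: the infimum over all finite
chains `z = p 0, p 1, …, p m = w` in `D` of the sums of the Lempert functions of the links. -/
def kobayashiEDist (D : Set E) (z w : E) : ENNReal :=
  sInf {r : ENNReal | ∃ (m : ℕ) (p : ℕ → E), p 0 = z ∧ p m = w ∧ (∀ j ≤ m, p j ∈ D) ∧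
    r = ∑ j ∈ Finset.range m, lempertFun D (p j) (p (j + 1))}

/-- The Kobayashi pseudodistance of a domain `D`, as a real number (for `D` open and connected
and points in `D`, the value in `[0, ∞]` is finite). -/
def kobayashiDist (D : Set E) (z w : E) : ℝ :=
  (kobayashiEDist D z w).toReal

/-- The small horosphere of center `x`, radius `R` and pole `z₀`; the upper limit is over `w ∈ D`
tending to `x`, and is taken in the extended reals. -/
def smallHorosphere (D : Set E) (z₀ x : E) (R : ℝ) : Set E :=
  {z | z ∈ D ∧
    limsup (fun w => ((kobayashiDist D z w - kobayashiDist D z₀ w : ℝ) : EReal)) (𝓝[D] x) <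
      ((1 / 2 * Real.log R : ℝ) : EReal)}

/-- The large horosphere of center `x`, radius `R` and pole `z₀`; the lower limit is over `w ∈ D`
tending to `x`, and is taken in the extended reals. -/
def largeHorosphere (D : Set E) (z₀ x : E) (R : ℝ) : Set E :=
  {z | z ∈ D ∧
    liminf (fun w => ((kobayashiDist D z w - kobayashiDist D z₀ w : ℝ) : EReal)) (𝓝[D] x) <
      ((1 / 2 * Real.log R : ℝ) : EReal)}

end

open Metric

/-! Shrinking `f` slightly towards an interior point `c` gives maps `F j → f` whose images keep a
positive distance from the complement of `D`, so each has a fixed point `w j`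
(`exists_fixedPoint_of_ball_subset`). A limit of the `w j` inside `D` would be fixed by `f`, so a
subsequence tends to some `x ∈ ∂D`, chosen independently of pole, radius and `k`. Since `F j`
contracts `k_D` and fixes `w j`, `k_D((F j)^k z, w j) ≤ k_D(z, w j)`. As `(F j)^k z → f^k z`, the
same holds for `f^k z` up to a vanishing error. This controls `f^k z` only along the sequence `w j`:
a limsup bound for `z` is used there, and only a liminf bound for `f^k z` results. Hence small
horospheres go into large ones. -/

/-! ### Earle–Hamilton fixed point theorem. -/

/-- One step of the Earle–Hamilton argument: if `F` maps `D` well inside `D`, then the derivatives of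
the maps `g ∘ F^[n]` decay geometrically. -/
theorem norm_fderiv_comp_iterate_le {E : Type*} [NormedAddCommGroup E] [NormedSpace ℂ E]
    {D : Set E} (hopen : IsOpen D) {M ε : ℝ} (hM : 0 < M) (hε : 0 < ε)
    (hdiam : ∀ x ∈ D, ∀ y ∈ D, ‖x - y‖ ≤ M) {F : E → E} (hF : DifferentiableOn ℂ F D)
    (hFD : ∀ z ∈ D, ball (F z) ε ⊆ D) (n : ℕ) :
    ∀ g : E → E, DifferentiableOn ℂ g D → MapsTo g D D → ∀ x, ball x ε ⊆ D →
      ‖fderiv ℂ (g ∘ F^[n]) x‖ ≤ ((1 + ε / (2 * M))⁻¹) ^ n * (M / ε) := by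
  have hmem : ∀ x, ball x ε ⊆ D → x ∈ D := fun x hx => hx (mem_ball_self hε)
  have hmaps : MapsTo F D D := fun z hz => hmem _ (hFD z hz)
  induction n with
  | zero =>
    intro g hg hgD x hx
    simp only [Function.iterate_zero, Function.comp_id, pow_zero, one_mul]
    -- Cauchy estimate: `g` sends a ball of radius `ε` into one of radius `M`.
    refine Complex.norm_fderiv_le_div_of_mapsTo_ball (hg.mono hx) (fun z hz => ?_) hε
    rw [mem_closedBall, dist_eq_norm]
    exact hdiam _ (hgD (hx hz)) _ (hgD (hmem x hx))
  | succ n ih =>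
    intro g hg hgD x hx
    -- With this `t`, the extra displacement `t * ‖F u - F y‖` is at most `ε / 2`, within the margin
    -- of `F`.
    set t : ℝ := ε / (2 * M) with ht
    have ht0 : 0 < t := by positivity
    set y := F^[n] x with hy
    have hyD : y ∈ D := hmaps.iterate n (hmem x hx)
    have hinner : MapsTo (fun u => F u + (t : ℂ) • (F u - F y)) D D := by
      intro u hu
      refine hFD u hu ?_
      rw [mem_ball, dist_eq_norm, add_sub_cancel_left, norm_smul, Complex.norm_real,
        Real.norm_of_nonneg ht0.le]
      calc t * ‖F u - F y‖ ≤ t * M := by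
            gcongr; exact hdiam _ (hmaps hu) _ (hmaps hyD)
        _ = ε / 2 := by rw [ht]; field_simp
        _ < ε := half_lt_self hε
    have hinnerd : DifferentiableOn ℂ (fun u => F u + (t : ℂ) • (F u - F y)) D :=
      hF.add ((hF.sub_const _).const_smul _)
    -- The modified map agrees with `F` at `y` but has derivative `(1 + t) • F'(y)` there. Feeding
    -- it to the hypothesis, which is quantified over all `g`, gains the factor `(1 + t)⁻¹`.
    have key := ih _ (hg.comp hinnerd hinner) (hgD.comp hinner) x hx
    have hA : HasFDerivAt F^[n] (fderiv ℂ F^[n] x) x :=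
      ((hF.iterate hmaps n).differentiableAt (hopen.mem_nhds (hmem x hx))).hasFDerivAt
    have hB : HasFDerivAt F (fderiv ℂ F y) y :=
      (hF.differentiableAt (hopen.mem_nhds hyD)).hasFDerivAt
    have hC : HasFDerivAt g (fderiv ℂ g (F y)) (F y) :=
      (hg.differentiableAt (hopen.mem_nhds (hmaps hyD))).hasFDerivAt
    have hB' : HasFDerivAt (fun u => F u + (t : ℂ) • (F u - F y))
        (fderiv ℂ F y + (t : ℂ) • fderiv ℂ F y) y := hB.add ((hB.sub_const _).const_smul _)
    have hC' : HasFDerivAt g (fderiv ℂ g (F y)) (F y + (t : ℂ) • (F y - F y)) := by simpa using hC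
    have h1 := ((hC'.comp y hB').comp x hA).fderiv
    have h2 := ((hC.comp y hB).comp x hA).fderiv
    have heq : fderiv ℂ ((g ∘ fun u => F u + (t : ℂ) • (F u - F y)) ∘ F^[n]) x
        = (1 + t : ℂ) • fderiv ℂ (g ∘ F^[n + 1]) x := by
      rw [Function.iterate_succ', ← Function.comp_assoc]
      refine h1.trans ?_
      rw [h2]
      ext v
      simp [add_smul]
    rw [heq, norm_smul] at key
    have hnorm : ‖(1 + t : ℂ)‖ = 1 + t := by
      rw [← Complex.ofReal_one, ← Complex.ofReal_add, Complex.norm_real,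
        Real.norm_of_nonneg (by positivity)]
    rw [hnorm] at key
    rw [pow_succ', mul_assoc, inv_mul_eq_div, le_div_iff₀' (by positivity)]
    exact key

/-- The **Earle–Hamilton fixed point theorem** for bounded convex domains. -/
theorem exists_fixedPoint_of_ball_subset {E : Type*} [NormedAddCommGroup E] [NormedSpace ℂ E]
    [CompleteSpace E] {D : Set E} (hne : D.Nonempty) (hopen : IsOpen D)
    (hbdd : Bornology.IsBounded D) (hconv : Convex ℝ D) {F : E → E} (hF : DifferentiableOn ℂ F D)
    {ε : ℝ} (hε : 0 < ε) (hFD : ∀ z ∈ D, ball (F z) ε ⊆ D) : ∃ w ∈ D, F w = w := by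
  obtain ⟨M, hM, hdiam⟩ : ∃ M : ℝ, 0 < M ∧ ∀ x ∈ D, ∀ y ∈ D, ‖x - y‖ ≤ M := by
    obtain ⟨C, hC⟩ := isBounded_iff.1 hbdd
    refine ⟨max C 1, by positivity, fun x hx y hy => ?_⟩
    rw [← dist_eq_norm]
    exact (hC hx hy).trans (le_max_left _ _)
  have hmem : ∀ x, ball x ε ⊆ D → x ∈ D := fun x hx => hx (mem_ball_self hε)
  have hmaps : MapsTo F D D := fun z hz => hmem _ (hFD z hz)
  -- The derivative bounds are uniform only on points with margin `ε`. This set is closed, hence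
  -- complete, as well as convex and invariant, so Banach's theorem applies on it.
  set K : Set E := {y | ball y ε ⊆ D} with hK
  have hKclosed : IsClosed K := by
    refine isClosed_of_closure_subset fun y hy z hz => ?_
    obtain ⟨u, hu, hyu⟩ := Metric.mem_closure_iff.1 hy (ε - dist z y) (by simpa using hz)
    refine hu ?_
    rw [mem_ball]
    linarith [dist_triangle z y u]
  have hKconv : Convex ℝ K := by
    intro y₁ h₁ y₂ h₂ a b ha hb hab z hz
    set v := z - (a • y₁ + b • y₂) with hv
    have hvn : ‖v‖ < ε := by rwa [mem_ball, dist_eq_norm] at hz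
    have hz' : z = a • (y₁ + v) + b • (y₂ + v) := by
      have : a • v + b • v = v := by rw [← add_smul, hab, one_smul]
      rw [smul_add, smul_add, add_add_add_comm, this, hv]
      abel
    rw [hz']
    exact hconv (h₁ (by simpa [mem_ball, dist_eq_norm] using hvn))
      (h₂ (by simpa [mem_ball, dist_eq_norm] using hvn)) ha hb hab
  have hc1 : (1 + ε / (2 * M))⁻¹ < 1 := inv_lt_one_of_one_lt₀ (by
    have : 0 < ε / (2 * M) := by positivity
    linarith)
  obtain ⟨n, hn⟩ : ∃ n : ℕ, ((1 + ε / (2 * M))⁻¹) ^ n * (M / ε) < 1 / 2 := by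
    have := (tendsto_pow_atTop_nhds_zero_of_lt_one (by positivity) hc1).mul_const (M / ε)
    rw [zero_mul] at this
    exact (this.eventually (gt_mem_nhds one_half_pos)).exists
  have hderiv : ∀ x ∈ K, ‖fderiv ℂ F^[n] x‖₊ ≤ (1 / 2 : NNReal) := by
    intro x hx
    have := norm_fderiv_comp_iterate_le hopen hM hε hdiam hF hFD n id differentiableOn_id
      (mapsTo_id D) x hx
    rw [Function.id_comp] at this
    rw [← NNReal.coe_le_coe]
    simpa using (this.trans hn.le)
  have hlip : LipschitzOnWith (1 / 2) F^[n] K :=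
    hKconv.lipschitzOnWith_of_nnnorm_fderiv_le (𝕜 := ℂ) (fun x hx =>
      (hF.iterate hmaps n).differentiableAt (hopen.mem_nhds (hmem x hx))) hderiv
  have hFK : MapsTo F K K := fun x hx => hFD x (hmem x hx)
  obtain ⟨z, hz⟩ := hne
  have : CompleteSpace K := hKclosed.isComplete.completeSpace_coe
  have : Nonempty K := ⟨⟨F z, hFD z hz⟩⟩
  have hcontr : ContractingWith (1 / 2) (hFK.restrict F K K)^[n] := by
    refine ⟨by rw [← NNReal.coe_lt_coe]; norm_num, ?_⟩
    rw [hFK.iterate_restrict n]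
    exact hlip.mapsToRestrict (hFK.iterate n)
  -- Only an iterate of `F` contracts; its unique fixed point is also fixed by `F`, which commutes
  -- with it.
  have hfix := hcontr.isFixedPt_fixedPoint_iterate
  exact ⟨_, hmem _ (Subtype.prop (ContractingWith.fixedPoint _ hcontr)),
    congrArg Subtype.val hfix⟩

/-! ### Lempert function and Kobayashi distance. -/

theorem lempertFun_le_of_ball_subset {E : Type*} [NormedAddCommGroup E] [NormedSpace ℂ E]
    {D : Set E} {z w : E} {r : ℝ} (hball : ball z r ⊆ D) (hw : w ∈ ball z r) :
    lempertFun D z w ≤ ENNReal.ofReal (poincareDist 0 ((‖w - z‖ / r : ℝ) : ℂ)) := by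
  have hwz : ‖w - z‖ < r := by rwa [← dist_eq_norm]
  have hr : 0 < r := (norm_nonneg _).trans_lt hwz
  -- The affine disk of radius `r` through `w` centred at `z`; when `w = z`, division by zero makes
  -- it constant.
  refine sInf_le ⟨fun ζ => z + ζ • ((r / ‖w - z‖ : ℝ) : ℂ) • (w - z), 0, _, ⟨?_, ?_⟩, by simp, ?_,
    by simp, ?_, rfl⟩
  · fun_prop
  · intro ζ hζ
    refine hball ?_
    rw [mem_ball_zero_iff] at hζ
    rw [mem_ball, dist_eq_norm, add_sub_cancel_left, norm_smul, norm_smul, Complex.norm_real,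
      Real.norm_of_nonneg (by positivity)]
    rcases eq_or_ne ‖w - z‖ 0 with h | h
    · simpa [h] using hr
    · rw [div_mul_cancel₀ _ h]
      exact mul_lt_of_lt_one_left hr hζ
  · rw [mem_ball_zero_iff, Complex.norm_real, Real.norm_of_nonneg (by positivity)]
    exact (div_lt_one hr).2 hwz
  · simp only
    rcases eq_or_ne ‖w - z‖ 0 with h | h
    · rw [h]; simpa using (sub_eq_zero.1 (norm_eq_zero.1 h)).symm
    · rw [smul_smul, ← Complex.ofReal_mul, div_mul_div_cancel₀ hr.ne', div_self h]
      simp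

/-- The Lempert function is continuous on the diagonal. -/
theorem tendsto_lempertFun_nhds {E : Type*} [NormedAddCommGroup E] [NormedSpace ℂ E]
    {D : Set E} (hopen : IsOpen D) {z : E} (hz : z ∈ D) :
    Tendsto (fun w => lempertFun D z w) (𝓝 z) (𝓝 0) := by
  obtain ⟨r, hr, hball⟩ := Metric.isOpen_iff.1 hopen z hz
  have hcont : ContinuousAt (fun w : E => poincareDist 0 ((‖w - z‖ / r : ℝ) : ℂ)) z := by
    unfold poincareDist
    refine continuousAt_const.mul (ContinuousAt.log (ContinuousAt.div ?_ ?_ ?_) ?_)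
    · simp only [map_zero, zero_mul, sub_zero, div_one, zero_sub]
      fun_prop
    · simp only [map_zero, zero_mul, sub_zero, div_one, zero_sub]
      fun_prop
    · simp
    · simp
  have hlim : Tendsto (fun w : E => ENNReal.ofReal (poincareDist 0 ((‖w - z‖ / r : ℝ) : ℂ)))
      (𝓝 z) (𝓝 0) := by
    have := (ENNReal.continuous_ofReal.continuousAt.comp hcont).tendsto
    simpa [Function.comp_def, poincareDist] using this
  refine tendsto_of_tendsto_of_tendsto_of_le_of_le' tendsto_const_nhds hlim
    (Eventually.of_forall fun _ => zero_le) ?_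
  filter_upwards [ball_mem_nhds z hr] with w hw
  exact lempertFun_le_of_ball_subset hball hw

theorem lempertFun_map_le {E : Type*} [NormedAddCommGroup E] [NormedSpace ℂ E]
    {D : Set E} {F : E → E} (hF : DifferentiableOn ℂ F D) (hFD : MapsTo F D D) (z w : E) :
    lempertFun D (F z) (F w) ≤ lempertFun D z w := by
  refine le_sInf ?_
  rintro r ⟨φ, ζ₀, ζ₁, ⟨hφ, hφD⟩, h₀, h₁, rfl, rfl, rfl⟩
  exact sInf_le ⟨F ∘ φ, ζ₀, ζ₁, ⟨hF.comp hφ hφD, hFD.comp hφD⟩, h₀, h₁, rfl, rfl, rfl⟩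

/-- Holomorphic self-maps do not increase the Kobayashi distance. -/
theorem kobayashiEDist_map_le {E : Type*} [NormedAddCommGroup E] [NormedSpace ℂ E]
    {D : Set E} {F : E → E} (hF : DifferentiableOn ℂ F D) (hFD : MapsTo F D D) (z w : E) :
    kobayashiEDist D (F z) (F w) ≤ kobayashiEDist D z w := by
  refine le_sInf ?_
  rintro r ⟨m, p, rfl, rfl, hp, rfl⟩
  refine le_trans (sInf_le ⟨m, F ∘ p, rfl, rfl, fun j hj => hFD (hp j hj), rfl⟩) ?_
  exact Finset.sum_le_sum fun j _ => lempertFun_map_le hF hFD _ _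

theorem kobayashiEDist_le_lempertFun_add {E : Type*} [NormedAddCommGroup E] [NormedSpace ℂ E]
    {D : Set E} {x : E} (hx : x ∈ D) (y w : E) :
    kobayashiEDist D x w ≤ lempertFun D x y + kobayashiEDist D y w := by
  rw [kobayashiEDist, kobayashiEDist, ENNReal.add_sInf]
  refine le_iInf₂ ?_
  rintro r ⟨m, p, rfl, rfl, hp, rfl⟩
  refine sInf_le ⟨m + 1, fun j => Nat.casesOn j x p, rfl, rfl, ?_, ?_⟩
  · rintro (_ | j) hj
    · exact hx
    · exact hp j (by omega)
  · rw [Finset.sum_range_succ', add_comm]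
    rfl

/-- The Kobayashi distance of a convex domain is finite. -/
theorem kobayashiEDist_ne_top {E : Type*} [NormedAddCommGroup E] [NormedSpace ℂ E]
    {D : Set E} (hopen : IsOpen D) (hconv : Convex ℝ D) {z w : E} (hz : z ∈ D) (hw : w ∈ D) :
    kobayashiEDist D z w ≠ ⊤ := by
  have hcompact : IsCompact (segment ℝ z w) := by
    rw [segment_eq_image_lineMap]
    exact isCompact_Icc.image AffineMap.lineMap_continuous
  obtain ⟨r, hr, hrD⟩ := hcompact.exists_thickening_subset_open hopen (hconv.segment_subset hz hw)
  -- Cutting the segment into `m` equal pieces makes each shorter than `r`, so each link lies in a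
  -- ball contained in `D`.
  obtain ⟨m, hm⟩ := exists_nat_gt (‖w - z‖ / r)
  have hm0 : (0 : ℝ) < m := lt_of_le_of_lt (by positivity) hm
  set p : ℕ → E := fun j => AffineMap.lineMap z w ((j : ℝ) / m) with hp
  have hseg : ∀ j ≤ m, p j ∈ segment ℝ z w := fun j hj => by
    rw [segment_eq_image_lineMap]
    exact ⟨_, ⟨by positivity, (div_le_one hm0).2 (by exact_mod_cast hj)⟩, rfl⟩
  have hle : kobayashiEDist D z w ≤ ∑ j ∈ Finset.range m, lempertFun D (p j) (p (j + 1)) :=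
    sInf_le ⟨m, p, by simp [hp], by simp [hp, hm0.ne'],
      fun j hj => hconv.segment_subset hz hw (hseg j hj), rfl⟩
  refine ne_top_of_le_ne_top (ENNReal.sum_ne_top.2 fun j hj => ?_) hle
  have hj' := (Finset.mem_range.1 hj).le
  refine ne_top_of_le_ne_top ENNReal.ofReal_ne_top
    (lempertFun_le_of_ball_subset (r := r)
      ((ball_subset_thickening (hseg j hj') r).trans hrD) ?_)
  rw [mem_ball, hp]
  simp only [dist_lineMap_lineMap]
  rw [Real.dist_eq, ← sub_div, Nat.cast_add, Nat.cast_one, add_sub_cancel_left,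
    abs_of_pos (by positivity), dist_comm, dist_eq_norm, one_div, inv_mul_lt_iff₀ hm0]
  exact (div_lt_iff₀ hr).1 hm

/-! ### Perturbing `f` towards an interior point. -/

/-- The homothety with centre `a` and ratio `s` carries the ball about `c` onto this one, and
convexity keeps it in `D`. The radius does not depend on `a`, so it gives a uniform margin for the
perturbed maps. -/
theorem ball_lineMap_subset {E : Type*} [NormedAddCommGroup E] [NormedSpace ℝ E]
    {D : Set E} (hconv : Convex ℝ D) {a c : E} {r s : ℝ} (ha : a ∈ D) (hball : ball c r ⊆ D)
    (hs : 0 < s) (hs1 : s ≤ 1) : ball (AffineMap.lineMap a c s) (s * r) ⊆ D := by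
  intro y hy
  set v := y - AffineMap.lineMap a c s with hv
  have hvn : ‖v‖ < s * r := by rwa [mem_ball, dist_eq_norm] at hy
  have hc : c + s⁻¹ • v ∈ D := by
    refine hball ?_
    rw [mem_ball, dist_eq_norm, add_sub_cancel_left, norm_smul, norm_inv,
      Real.norm_of_nonneg hs.le]
    exact (inv_mul_lt_iff₀ hs).2 hvn
  have : y = AffineMap.lineMap a (c + s⁻¹ • v) s := by
    rw [AffineMap.lineMap_apply_module', add_sub_right_comm, smul_add, smul_inv_smul₀ hs.ne',
      add_right_comm, ← AffineMap.lineMap_apply_module', hv]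
    abel
  rw [this]
  exact hconv.lineMap_mem ha hc ⟨hs.le, hs1⟩

/-- The fixed points of suitable perturbations of `f` converge to a boundary point. -/
theorem exists_approximating_fixedPoints {E : Type*} [NormedAddCommGroup E] [NormedSpace ℂ E]
    [ProperSpace E] {D : Set E}
    (hne : D.Nonempty) (hopen : IsOpen D) (hbdd : Bornology.IsBounded D) (hconv : Convex ℝ D)
    {f : E → E} (hf : DifferentiableOn ℂ f D) (hfD : MapsTo f D D) (hfix : ∀ z ∈ D, f z ≠ z) :
    ∃ x ∈ frontier D, ∃ (F : ℕ → E → E) (w : ℕ → E),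
      (∀ j, DifferentiableOn ℂ (F j) D) ∧ (∀ j, MapsTo (F j) D D) ∧
      (∀ j, w j ∈ D ∧ F j (w j) = w j) ∧ Tendsto w atTop (𝓝 x) ∧
      ∀ z ∈ D, ∀ u : ℕ → E, Tendsto u atTop (𝓝 z) →
        Tendsto (fun j => F j (u j)) atTop (𝓝 (f z)) := by
  obtain ⟨c, hc⟩ := hne
  obtain ⟨r, hr, hball⟩ := Metric.isOpen_iff.1 hopen c hc
  set F : ℕ → E → E := fun j z => AffineMap.lineMap (f z) c (1 / ((j : ℝ) + 1)) with hFdef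
  have hs : ∀ j : ℕ, 0 < 1 / ((j : ℝ) + 1) := fun j => Nat.one_div_pos_of_nat
  have hs1 : ∀ j : ℕ, 1 / ((j : ℝ) + 1) ≤ 1 := fun j => by
    rw [div_le_one (by positivity)]; linarith [(Nat.cast_nonneg j : (0 : ℝ) ≤ j)]
  have hFd : ∀ j, DifferentiableOn ℂ (F j) D := fun j => by
    simp only [hFdef, AffineMap.lineMap_apply_module']
    exact ((hf.const_sub c).const_smul _).add hf
  have hFball : ∀ j, ∀ z ∈ D, ball (F j z) (1 / ((j : ℝ) + 1) * r) ⊆ D := fun j z hz =>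
    ball_lineMap_subset hconv (hfD hz) hball (hs j) (hs1 j)
  have hFlim : ∀ z ∈ D, ∀ u : ℕ → E, Tendsto u atTop (𝓝 z) →
      ∀ φ : ℕ → ℕ, StrictMono φ → Tendsto (fun j => F (φ j) (u j)) atTop (𝓝 (f z)) := by
    intro z hz u hu φ hφ
    have h1 : Tendsto (fun j => f (u j)) atTop (𝓝 (f z)) :=
      ((hf.differentiableAt (hopen.mem_nhds hz)).continuousAt.tendsto).comp hu
    have h2 : Tendsto (fun j => 1 / ((φ j : ℝ) + 1)) atTop (𝓝 0) :=
      (tendsto_one_div_add_atTop_nhds_zero_nat (𝕜 := ℝ)).comp hφ.tendsto_atTop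
    have h3 := (h2.smul (h1.const_sub c)).add h1
    simpa [hFdef, AffineMap.lineMap_apply_module'] using h3
  choose w hwD hwF using fun j => exists_fixedPoint_of_ball_subset ⟨c, hc⟩ hopen hbdd hconv
    (hFd j) (mul_pos (hs j) hr) (hFball j)
  obtain ⟨x, hx, φ, hφ, hlim⟩ := tendsto_subseq_of_bounded hbdd hwD
  -- At a limit point in `D`, passing to the limit in `F (φ j) (w (φ j)) = w (φ j)` would give `f x
  -- = x`.
  have hxD : x ∉ D := fun hxD => hfix x hxD <| by
    have := hFlim x hxD _ hlim φ hφ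
    simp only [Function.comp_apply, hwF] at this
    exact tendsto_nhds_unique this hlim
  refine ⟨x, by rw [hopen.frontier_eq]; exact ⟨hx, hxD⟩, fun j => F (φ j), w ∘ φ,
    fun j => hFd _, fun j z hz => ?_, fun j => ⟨hwD _, hwF _⟩, hlim,
    fun z hz u hu => hFlim z hz u hu φ hφ⟩
  exact hFball (φ j) z hz (mem_ball_self (mul_pos (hs _) hr))

/-! ### Horospheres. -/

theorem image_iterate_smallHorosphere_subset {E : Type*} [NormedAddCommGroup E] [NormedSpace ℂ E]
    {D : Set E} (hopen : IsOpen D) (hconv : Convex ℝ D) {f : E → E} (hfD : MapsTo f D D)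
    {x : E} {F : ℕ → E → E} {w : ℕ → E} (hF : ∀ j, DifferentiableOn ℂ (F j) D)
    (hFD : ∀ j, MapsTo (F j) D D) (hw : ∀ j, w j ∈ D ∧ F j (w j) = w j)
    (hlim : Tendsto w atTop (𝓝 x))
    (hFlim : ∀ z ∈ D, ∀ u : ℕ → E, Tendsto u atTop (𝓝 z) →
        Tendsto (fun j => F j (u j)) atTop (𝓝 (f z)))
    (z₀ : E) (R : ℝ) (k : ℕ) :
    f^[k] '' smallHorosphere D z₀ x R ⊆ largeHorosphere D z₀ x R := by
  rintro _ ⟨z, ⟨hz, hlt⟩, rfl⟩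
  have hfz : f^[k] z ∈ D := hfD.iterate k hz
  refine ⟨hfz, ?_⟩
  have hlim' : Tendsto w atTop (𝓝[D] x) :=
    tendsto_nhdsWithin_iff.2 ⟨hlim, Eventually.of_forall fun j => (hw j).1⟩
  have hiter : Tendsto (fun j => (F j)^[k] z) atTop (𝓝 (f^[k] z)) := by
    clear hfz
    induction k with
    | zero => exact tendsto_const_nhds
    | succ k ih =>
      simp only [Function.iterate_succ_apply']
      exact hFlim _ (hfD.iterate k hz) _ ih
  have hsmall := (tendsto_lempertFun_nhds hopen hfz).comp hiter
  -- Half of the gap between `c` and `1 / 2 * log R` absorbs the error from replacing `(F j)^[k] z`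
  -- by `f^[k] z`; the other half keeps the final inequality strict.
  obtain ⟨c, hc₁, hc₂⟩ := EReal.lt_iff_exists_real_btwn.1 hlt
  rw [EReal.coe_lt_coe_iff] at hc₂
  have hδ : 0 < (1 / 2 * Real.log R - c) / 2 := by linarith
  have h1 := hlim'.eventually (eventually_lt_of_limsup_lt hc₁)
  have h2 := hsmall.eventually (gt_mem_nhds (ENNReal.ofReal_pos.2 hδ))
  have h3 : ∀ᶠ j in atTop,
      ((kobayashiDist D (f^[k] z) (w j) - kobayashiDist D z₀ (w j) : ℝ) : EReal) ≤
        ((c + (1 / 2 * Real.log R - c) / 2 : ℝ) : EReal) := by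
    filter_upwards [h1, h2] with j hj₁ hj₂
    rw [EReal.coe_lt_coe_iff] at hj₁
    rw [EReal.coe_le_coe_iff]
    have hfixed : (F j)^[k] (w j) = w j := Function.iterate_fixed (hw j).2 k
    have hle : kobayashiEDist D (f^[k] z) (w j) ≤
        ENNReal.ofReal ((1 / 2 * Real.log R - c) / 2) + kobayashiEDist D z (w j) := by
      refine (kobayashiEDist_le_lempertFun_add hfz ((F j)^[k] z) (w j)).trans ?_
      refine add_le_add hj₂.le ?_
      have := kobayashiEDist_map_le ((hF j).iterate (hFD j) k) ((hFD j).iterate k) z (w j)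
      rwa [hfixed] at this
    have hfin := kobayashiEDist_ne_top hopen hconv hz (hw j).1
    have hreal := ENNReal.toReal_mono (ENNReal.add_ne_top.2 ⟨ENNReal.ofReal_ne_top, hfin⟩) hle
    rw [ENNReal.toReal_add ENNReal.ofReal_ne_top hfin, ENNReal.toReal_ofReal hδ.le] at hreal
    simp only [kobayashiDist] at hj₁ ⊢
    linarith
  -- The sequence `w` tends to `x` within `D`, so the liminf along it dominates the full one.
  calc liminf (fun u => ((kobayashiDist D (f^[k] z) u - kobayashiDist D z₀ u : ℝ) : EReal)) (𝓝[D] x)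
      ≤ liminf (fun u => ((kobayashiDist D (f^[k] z) u - kobayashiDist D z₀ u : ℝ) : EReal))
          (map w atTop) := liminf_le_liminf_of_le hlim'
    _ ≤ ((c + (1 / 2 * Real.log R - c) / 2 : ℝ) : EReal) :=
        liminf_le_of_frequently_le' (Eventually.frequently h3)
    _ < _ := by rw [EReal.coe_lt_coe_iff]; linarith

theorem mainTheorem8 {n : ℕ} (D : Set (EuclideanSpace ℂ (Fin n)))
    (hne : D.Nonempty) (hopen : IsOpen D) (hbdd : Bornology.IsBounded D) (hconv : Convex ℝ D)
    (f : EuclideanSpace ℂ (Fin n) → EuclideanSpace ℂ (Fin n))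
    (hf : DifferentiableOn ℂ f D) (hfD : MapsTo f D D) (hfix : ∀ z ∈ D, f z ≠ z) :
    ∃ x ∈ frontier D, ∀ z₀ ∈ D, ∀ R : ℝ, 0 < R → ∀ k : ℕ,
      f^[k] '' smallHorosphere D z₀ x R ⊆ largeHorosphere D z₀ x R := by
  obtain ⟨x, hx, F, w, hF, hFD, hw, hlim, hFlim⟩ :=
    exists_approximating_fixedPoints hne hopen hbdd hconv hf hfD hfix
  exact ⟨x, hx, fun z₀ _ R _ k =>
    image_iterate_smallHorosphere_subset hopen hconv hfD hF hFD hw hlim hFlim z₀ R k⟩
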